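/- Consider the energy buffer of a relay R1 that stores harvested energy and spends $M_{R1}>0$ per transmission. Let $\lambda_1>0$, $R_0>0$, $\Gamma_{th}=2^{R_0}-1$, $W_{SR2},W_{R1R2}>0$. Let $(p_S,p_{SR1},p_{SR2},p_1,p_2,p_3)$ be a probability vector and let $\mathfrak c,\mathfrak d,\mathfrak o,\mathfrak f,\mathfrak g,PU2\in[0,1]$. In each time slot $i=0,1,2,\dots$ the following are drawn, independently of each other, of the other slots and of the initial level $B_1(0)\ge 0$: a transmitter-candidate set $TCs$, equal to $\{S\}$, $\{S,R1\}$, $\{S,R2\}$, $(S,R1,R2)_1$, $(S,R1,R2)_2$, $(S,R1,R2)_3$ with probabilities $p_S,p_{SR1},p_{SR2},p_1,p_2,p_3$ (the last three are all written $TCs=\{S,R1,R2\}$); events $\mathbb C,\mathbb D,\mathbb O,\mathbb F,\mathbb G$ (failure of the various links to the destination to reach the SNR threshold) with probabilities $\mathfrak c,\mathfrak d,\mathfrak o,\mathfrak f,\mathfrak g$; the event $\mathbb E_2$ that the second relay R2 has enough energy to transmit, with probability $PU2$; link SNRs $\gamma_{SR2}(i)$ and $\gamma_{R1R2}(i)$,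 exponential with rates $W_{SR2}$ and $W_{R1R2}$; and the harvested energy $X(i)$, exponential with mean $1/\lambda_1$. The buffer level evolves by $B_1(i+1)=B_1(i)-M_{R1}+X(i)$ if $B_1(i)\ge M_{R1}$ and one of the following holds in slot $i$: 1. $TCs=\{S,R1\}$ and $\mathbb C\cap\overline{\mathbb D}$; 2. $TCs=\{S,R1\}$, $\mathbb C\cap\mathbb D$, $\gamma_{SR2}(i)<\Gamma_{th}$ and $\gamma_{R1R2}(i)\ge\Gamma_{th}$; 3. $TCs=\{S,R1,R2\}$ and $\mathbb E_2\cap\mathbb O\cap\mathbb F\cap\overline{\mathbb G}$; 4. $TCs=\{S,R1,R2\}$ and $\overline{\mathbb E_2}\cap\mathbb O\cap\overline{\mathbb G}$; and by $B_1(i+1)=B_1(i)+X(i)$ otherwise. Put $$b_1=p_{SR1}\,\mathfrak c\big((1-\mathfrak d)+\mathfrak d(1-e^{-W_{SR2}\Gamma_{th}})e^{-W_{R1R2}\Gamma_{th}}\big)+PU2\,(p_1+p_2+p_3)\,\mathfrak o\,\mathfrak f\,(1-\mathfrak g)+(1-PU2)(p_1+p_2+p_3)\,\mathfrak o\,(1-\mathfrak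 g)$$ and $\psi_{R1}=\lambda_1M_{R1}b_1$. If $\psi_{R1}\le 1$, then the Markov chain $B_1(i)$ has no stationary distribution (no probability measure on $[0,\infty)$ is invariant), and the buffer almost always holds more than $M_{R1}$: for every initial level $B_1(0)\ge0$ independent of the slot data, $\Pr\{B_1(i)>M_{R1}\}\to1$ as $i\to\infty$, and almost surely the fraction of the first $n$ slots in which $B_1(i)>M_{R1}$ tends to $1$ as $n\to\infty$. If moreover $\psi_{R1}<1$, then almost surely $B_1(i)>M_{R1}$ for all $i$ from some finite slot on. -/

import Mathlib

open MeasureTheory ProbabilityTheory Filter Topology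

/-- The possible transmitter-candidate sets: `{S}`, `{S,R1}`, `{S,R2}` and the three variants
`(S,R1,R2)₁`, `(S,R1,R2)₂`, `(S,R1,R2)₃` of `{S,R1,R2}`. -/
inductive TCSet
  | S
  | SR1
  | SR2
  | SR1R2a
  | SR1R2b
  | SR1R2c

instance : MeasurableSpace TCSet := ⊤

instance : DiscreteMeasurableSpace TCSet := ⟨fun _ => trivial⟩

/-- `TCs = {S,R1,R2}`, in any of its three variants. -/
def TCSet.IsAll : TCSet → Prop
  | .S | .SR1 | .SR2 => False
  | .SR1R2a | .SR1R2b | .SR1R2c => True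

/-- The conditions of a slot that enter the update rule of R1 through their probability only.
`C`, `D` : with TCs `{S,R1}`, the combined SNR at the destination stays below the threshold when
S (resp. R1) transmits.
`O`, `F`, `G` : with TCs `{S,R1,R2}`, the combined SNR at the destination stays below the threshold
when S (resp. R2, R1) transmits.
`E2` : the buffer of R2 holds enough energy for a transmission, `B₂(i) ≥ M_{R2}`. -/
inductive Cond
  | C
  | D
  | O
  | F
  | G
  | E2
  deriving DecidableEq

instance : Fintype Cond where
  elems := {.C, .D, .O, .F, .G, .E2}
  complete k := by cases k <;> simp

/-- The parameters of the network that govern the energy buffer of R1. -/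
structure R1Network where
  /-- transmit energy `M_{R1}` of R1 -/
  M : ℝ
  M_pos : 0 < M
  /-- harvesting parameter `λ₁` of R1 (mean harvested energy per slot is `1/λ₁`) -/
  lam : ℝ
  lam_pos : 0 < lam
  /-- target rate -/
  R0 : ℝ
  R0_pos : 0 < R0
  /-- rate of the exponential SNR of the link S–R2 -/
  WSR2 : ℝ
  WSR2_pos : 0 < WSR2
  /-- rate of the exponential SNR of the link R1–R2 -/
  WR1R2 : ℝ
  WR1R2_pos : 0 < WR1R2
  /-- occurrence probabilities `p_S, p_{SR1}, p_{SR2}, p₁, p₂, p₃` of the candidate sets -/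
  p : PMF TCSet
  /-- probabilities `𝔠, 𝔡, 𝔬, 𝔣, 𝔤` and `PU2 = Pr{B₂(i) ≥ M_{R2}}` of the conditions -/
  prob : Cond → unitInterval

/-- The random data of one time slot: candidate set, truth values of the conditions,
SNR of S–R2, SNR of R1–R2, harvested energy. -/
abbrev Slot := TCSet × (Cond → Bool) × ℝ × ℝ × ℝ

namespace Slot

def tc (s : Slot) : TCSet := s.1

def holds (s : Slot) (k : Cond) : Prop := s.2.1 k = true

def snrSR2 (s : Slot) : ℝ := s.2.2.1

def snrR1R2 (s : Slot) : ℝ := s.2.2.2.1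

/-- harvested energy `X(i)` -/
def X (s : Slot) : ℝ := s.2.2.2.2

end Slot

noncomputable section

namespace R1Network

variable (N : R1Network)

/-- SNR threshold `Γ_th = 2^{R₀} - 1`. -/
def Gth : ℝ := (2 : ℝ) ^ N.R0 - 1

/-- The law of one slot: all the ingredients are independent. -/
def slotLaw : Measure Slot :=
  N.p.toMeasure.prod <|
    (Measure.pi fun k => bernoulliMeasure true false (N.prob k)).prod <|
      (expMeasure N.WSR2).prod <| (expMeasure N.WR1R2).prod (expMeasure N.lam)

/-- The condition under which R1, with buffer level `x`, transmits in the slot `s` and so spends the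
energy `M_{R1}`. -/
def Spends (x : ℝ) (s : Slot) : Prop :=
  (s.tc = .SR1 ∧ N.M ≤ x ∧ s.holds .C ∧ ¬ s.holds .D) ∨
  (s.tc = .SR1 ∧ N.M ≤ x ∧ s.holds .C ∧ s.holds .D ∧ s.snrSR2 < N.Gth ∧ N.Gth ≤ s.snrR1R2) ∨
  (s.tc.IsAll ∧ s.holds .E2 ∧ s.holds .O ∧ s.holds .F ∧ N.M ≤ x ∧ ¬ s.holds .G) ∨
  (s.tc.IsAll ∧ ¬ s.holds .E2 ∧ s.holds .O ∧ N.M ≤ x ∧ ¬ s.holds .G)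

open Classical in
/-- Buffer update: `B₁(i+1) = B₁(i) - M_{R1} + X(i)` if R1 transmits, else
`B₁(i+1) = B₁(i) + X(i)`. -/
def step (x : ℝ) (s : Slot) : ℝ :=
  if N.Spends x s then x - N.M + s.X else x + s.X

/-- `b₁`, with `p_{SR1R2} = p₁ + p₂ + p₃`. -/
def b1 : ℝ :=
  let pSR1 : ℝ := (N.p .SR1).toReal
  let pAll : ℝ := (N.p .SR1R2a).toReal + (N.p .SR1R2b).toReal + (N.p .SR1R2c).toReal
  let c : ℝ := N.prob .C
  let d : ℝ := N.prob .D
  let o : ℝ := N.prob .O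
  let f : ℝ := N.prob .F
  let g : ℝ := N.prob .G
  let PU2 : ℝ := N.prob .E2
  pSR1 * c * ((1 - d) + d * (1 - Real.exp (-N.WSR2 * N.Gth)) * Real.exp (-N.WR1R2 * N.Gth))
    + PU2 * (pAll * o * f * (1 - g)) + (1 - PU2) * (pAll * o * (1 - g))

/-- `ψ_{R1} = λ₁ M_{R1} b₁`. -/
def psi : ℝ := N.lam * N.M * N.b1

/-- `π` is a stationary distribution of the buffer level: a probability measure on `[0,∞)` that one
update with fresh slot data preserves. -/
def IsStationary (π : Measure ℝ) : Prop :=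
  IsProbabilityMeasure π ∧ (∀ᵐ x ∂π, 0 ≤ x) ∧
    (π.prod N.slotLaw).map (fun z => N.step z.1 z.2) = π

/-- `B` is the energy-buffer process of R1 driven by the i.i.d. slot data `ξ`, from an arbitrary
non-negative initial level independent of `ξ`. -/
structure IsEnergyBuffer {Ω : Type*} [MeasurableSpace Ω] (μ : Measure Ω)
    (ξ : ℕ → Ω → Slot) (B : ℕ → Ω → ℝ) : Prop where
  measurable_slot : ∀ i, Measurable (ξ i)
  law_slot : ∀ i, μ.map (ξ i) = N.slotLaw
  indep_slot : iIndepFun ξ μ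
  measurable_init : Measurable (B 0)
  init_nonneg : ∀ ω, 0 ≤ B 0 ω
  indep_init : IndepFun (B 0) (fun ω i => ξ i ω) μ
  update : ∀ i ω, B (i + 1) ω = N.step (B i ω) (ξ i ω)

/-- The update map is measurable, so the push-forward in `IsStationary` is the genuine one. -/
lemma measurable_step : Measurable (fun z : ℝ × Slot => N.step z.1 z.2) := by
  have hX : Measurable fun z : ℝ × Slot => z.2.X :=
    measurable_snd.comp (measurable_snd.comp (measurable_snd.comp
      (measurable_snd.comp measurable_snd)))
  have hT : Measurable fun z : ℝ × Slot => z.2.tc := measurable_fst.comp measurable_snd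
  have h1 : Measurable fun z : ℝ × Slot => z.2.snrSR2 :=
    measurable_fst.comp (measurable_snd.comp (measurable_snd.comp measurable_snd))
  have h2 : Measurable fun z : ℝ × Slot => z.2.snrR1R2 :=
    measurable_fst.comp (measurable_snd.comp (measurable_snd.comp
      (measurable_snd.comp measurable_snd)))
  have hk : ∀ k, MeasurableSet {z : ℝ × Slot | z.2.holds k} := fun k => by
    have h : Measurable fun z : ℝ × Slot => z.2.2.1 k :=
      (measurable_pi_apply k).comp (measurable_fst.comp (measurable_snd.comp measurable_snd))
    exact h (MeasurableSet.singleton true)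
  have hS : MeasurableSet {z : ℝ × Slot | z.2.tc = .SR1} := hT (MeasurableSet.singleton _)
  have hA : MeasurableSet {z : ℝ × Slot | z.2.tc.IsAll} :=
    hT (t := {t | t.IsAll}) (MeasurableSet.of_discrete)
  have hx : MeasurableSet {z : ℝ × Slot | N.M ≤ z.1} :=
    measurableSet_le measurable_const measurable_fst
  have hg1 : MeasurableSet {z : ℝ × Slot | z.2.snrSR2 < N.Gth} :=
    measurableSet_lt h1 measurable_const
  have hg2 : MeasurableSet {z : ℝ × Slot | N.Gth ≤ z.2.snrR1R2} :=
    measurableSet_le measurable_const h2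
  have hsp : MeasurableSet {z : ℝ × Slot | N.Spends z.1 z.2} :=
    (hS.inter (hx.inter ((hk .C).inter (hk .D).compl))).union <|
      (hS.inter (hx.inter ((hk .C).inter ((hk .D).inter (hg1.inter hg2))))).union <|
        (hA.inter ((hk .E2).inter ((hk .O).inter ((hk .F).inter (hx.inter
          (hk .G).compl))))).union
          (hA.inter ((hk .E2).compl.inter ((hk .O).inter (hx.inter (hk .G).compl))))
  exact Measurable.ite hsp ((measurable_fst.sub measurable_const).add hX)
    (measurable_fst.add hX)

end R1Network

end

/-! By independence, b₁ is the probability that a slot asks R1 to transmit (`slotLaw_activeSet`). If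
the buffer imposed no restriction, its level would be a random walk with steps X − M·1_active of
mean (1 − ψ)/λ ≥ 0. The true level is nonnegative and its increments are at least these steps
(`add_incr_le_step`). It therefore dominates the walk reflected at 0 and restarted from 0 at any
chosen time (`lindley_le`), and everything reduces to showing that this walk leaves every bounded
set in probability (`tendsto_iterate_incrLaw`).

If ψ < 1, the step has Laplace transform R < 1 at some θ, and a Chernoff bound makes the probability
of low levels decay geometrically; Borel–Cantelli then gives the eventual statement.

If ψ = 1, the drift vanishes and R(θ) ≤ 1 + Cθ². Take x ↦ e^{-θx} as Lyapunov function. On average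
it gains at most Cθ² per step, but near 0 reflection cuts off an amount of order θ. Summed over n
steps, the expected number of visits near 0 is at most of order 1/θ + nθ; θ = n^{-1/2} gives order
√n. Since the walk started at 0 is stochastically increasing in time, its probability of being low
at time n is O(n^{-1/2}).

An invariant probability would give every bounded set mass 0. For the time averages, the level at
time i + k is compared with the walk restarted at time i. Along one residue class modulo k these
walks use disjoint blocks of steps, so the strong law applies; then k is taken large. -/

open scoped ENNReal

/-! ### The reflected random walk through its transition operator. -/

noncomputable section

/-- The transition operator of the random walk with step law `ν`, reflected at `0`. -/
def lindleyOp (ν : Measure ℝ) (f : ℝ → ℝ≥0∞) (x : ℝ) : ℝ≥0∞ := ∫⁻ z, f (max 0 (x + z)) ∂ν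

/-- The indicator function of `(-∞, K]`. -/
def lowLevel (K : ℝ) : ℝ → ℝ≥0∞ := Set.indicator (Set.Iic K) 1

/-- The decreasing exponential `x ↦ e^{-θx}`. -/
def expDecay (θ x : ℝ) : ℝ≥0∞ := ENNReal.ofReal (Real.exp (-(θ * x)))

lemma antitone_lowLevel (K : ℝ) : Antitone (lowLevel K) := by
  intro x y hxy
  unfold lowLevel
  by_cases hy : y ≤ K
  · have hx : x ≤ K := hxy.trans hy
    simp [hx, hy]
  · simp [hy]

lemma antitone_expDecay {θ : ℝ} (hθ : 0 ≤ θ) : Antitone (expDecay θ) := by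
  intro x y hxy
  unfold expDecay
  gcongr

lemma measurable_expDecay (θ : ℝ) : Measurable (expDecay θ) := by
  unfold expDecay; fun_prop

lemma expDecay_add (θ x y : ℝ) : expDecay θ (x + y) = expDecay θ x * expDecay θ y := by
  unfold expDecay
  rw [← ENNReal.ofReal_mul (Real.exp_pos _).le, ← Real.exp_add]
  congr 2; ring

lemma expDecay_zero (θ : ℝ) : expDecay θ 0 = 1 := by simp [expDecay]

lemma expDecay_le_one {θ x : ℝ} (hθ : 0 ≤ θ) (hx : 0 ≤ x) : expDecay θ x ≤ 1 := by
  rw [← expDecay_zero θ]; exact antitone_expDecay hθ hx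

namespace lindleyOp

variable {ν : Measure ℝ} {f g : ℝ → ℝ≥0∞}

lemma antitone (hf : Antitone f) : Antitone (lindleyOp ν f) := by
  intro x y hxy
  refine lintegral_mono fun z => hf ?_
  gcongr

lemma antitone_iterate (hf : Antitone f) (n : ℕ) : Antitone ((lindleyOp ν)^[n] f) := by
  induction n with
  | zero => exact hf
  | succ n ih => rw [Function.iterate_succ_apply']; exact antitone ih

/-- Reflection puts the walk in [0, ∞) after one step, so negative arguments never matter. This lets
the drift inequality, valid only for `0 ≤ x`, be iterated. -/
lemma le_of_le_on_nonneg (h : ∀ x, 0 ≤ x → f x ≤ g x) (x : ℝ) :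
    lindleyOp ν f x ≤ lindleyOp ν g x :=
  lintegral_mono fun _ => h _ (le_max_left _ _)

lemma monotone : Monotone (lindleyOp ν) := fun _ _ h =>
  le_of_le_on_nonneg fun x _ => h x

lemma iterate_const_mul {c : ℝ≥0∞} (hc : c ≠ ∞) (n : ℕ) :
    (lindleyOp ν)^[n] (fun x => c * f x) = fun x => c * (lindleyOp ν)^[n] f x := by
  induction n with
  | zero => rfl
  | succ n ih =>
    funext x
    rw [Function.iterate_succ_apply', Function.iterate_succ_apply', ih]
    exact lintegral_const_mul' _ _ hc

/-- The first step from 0 can only lead upwards, and the remaining `n` steps preserve the order of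
starting points. -/
lemma iterate_succ_zero_le [IsProbabilityMeasure ν] (hf : Antitone f) (n : ℕ) :
    (lindleyOp ν)^[n + 1] f 0 ≤ (lindleyOp ν)^[n] f 0 := by
  rw [Function.iterate_succ_apply']
  calc lindleyOp ν ((lindleyOp ν)^[n] f) 0
      ≤ ∫⁻ _, (lindleyOp ν)^[n] f 0 ∂ν :=
        lintegral_mono fun z => antitone_iterate hf n (le_max_left _ _)
    _ = _ := by simp

lemma antitone_iterate_zero [IsProbabilityMeasure ν] (hf : Antitone f) :
    Antitone fun n : ℕ => (lindleyOp ν)^[n] f 0 :=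
  antitone_nat_of_succ_le fun n => iterate_succ_zero_le hf n

lemma lintegral_expDecay_shift (θ x : ℝ) :
    ∫⁻ z, expDecay θ (x + z) ∂ν = (∫⁻ z, expDecay θ z ∂ν) * expDecay θ x := by
  simp_rw [expDecay_add]
  rw [lintegral_const_mul' _ _ (by simp [expDecay]), mul_comm]

lemma expDecay_le {θ : ℝ} (hθ : 0 ≤ θ) (x : ℝ) :
    lindleyOp ν (expDecay θ) x ≤ (∫⁻ z, expDecay θ z ∂ν) * expDecay θ x := by
  rw [← lintegral_expDecay_shift]
  exact lintegral_mono fun z => antitone_expDecay hθ (le_max_right _ _)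

lemma iterate_expDecay_le {θ : ℝ} (hθ : 0 ≤ θ) (hR : ∫⁻ z, expDecay θ z ∂ν ≠ ∞) (n : ℕ) (x : ℝ) :
    (lindleyOp ν)^[n] (expDecay θ) x ≤ (∫⁻ z, expDecay θ z ∂ν) ^ n * expDecay θ x := by
  induction n generalizing x with
  | zero => simp
  | succ n ih =>
    rw [Function.iterate_succ_apply']
    calc lindleyOp ν ((lindleyOp ν)^[n] (expDecay θ)) x
        ≤ lindleyOp ν (fun y => (∫⁻ z, expDecay θ z ∂ν) ^ n * expDecay θ y) x := monotone ih x
      _ = (∫⁻ z, expDecay θ z ∂ν) ^ n * lindleyOp ν (expDecay θ) x :=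
        lintegral_const_mul' _ _ (ENNReal.pow_ne_top hR)
      _ ≤ _ := by
        rw [pow_succ, mul_assoc]
        gcongr
        exact expDecay_le hθ x

/-- Geometric decay of the mass near the origin, for a step law with positive drift. -/
lemma iterate_lowLevel_le {θ : ℝ} (hθ : 0 ≤ θ) (hR : ∫⁻ z, expDecay θ z ∂ν ≠ ∞) (K : ℝ) (n : ℕ) :
    (lindleyOp ν)^[n] (lowLevel K) 0 ≤
      ENNReal.ofReal (Real.exp (θ * K)) * (∫⁻ z, expDecay θ z ∂ν) ^ n := by
  -- Chernoff: `e^{θ(K - x)} ≥ 1` for `x ≤ K`.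
  have h : lowLevel K ≤ fun x => ENNReal.ofReal (Real.exp (θ * K)) * expDecay θ x := by
    intro x
    unfold lowLevel expDecay
    by_cases hx : x ≤ K
    · simp only [Set.mem_Iic, hx, Set.indicator_of_mem, Pi.one_apply]
      rw [← ENNReal.ofReal_mul (Real.exp_pos _).le, ← Real.exp_add, ← ENNReal.ofReal_one]
      apply ENNReal.ofReal_le_ofReal
      rw [Real.one_le_exp_iff]
      nlinarith [mul_le_mul_of_nonneg_left hx hθ]
    · simp [hx]
  calc _ ≤ (lindleyOp ν)^[n] (fun x => ENNReal.ofReal (Real.exp (θ * K)) * expDecay θ x) 0 :=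
        monotone.iterate n h 0
    _ = ENNReal.ofReal (Real.exp (θ * K)) * (lindleyOp ν)^[n] (expDecay θ) 0 := by
        rw [iterate_const_mul ENNReal.ofReal_ne_top]
    _ ≤ _ := by
        gcongr
        simpa [expDecay_zero] using iterate_expDecay_le (ν := ν) hθ hR n 0

/-- From `x ≤ a/2`, a step below `-a` would lead the free walk below `-a/2`, where the exponential
is at least `1 + θa/2`. Reflection replaces this value by 1, and the saving pays for the `lowLevel`
term. -/
lemma expDecay_add_lowLevel_le {θ a ε : ℝ} (hθ : 0 ≤ θ)
    (hε : 0 ≤ ε) (hR : ∫⁻ z, expDecay θ z ∂ν ≤ ENNReal.ofReal (1 + ε)) {x : ℝ} (hx : 0 ≤ x) :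
    lindleyOp ν (expDecay θ) x
      + ENNReal.ofReal (θ * (a / 2)) * ν (Set.Iic (-a)) * lowLevel (a / 2) x
      ≤ expDecay θ x + ENNReal.ofReal ε := by
  have h1 : lindleyOp ν (expDecay θ) x
      + ENNReal.ofReal (θ * (a / 2)) * ν (Set.Iic (-a)) * lowLevel (a / 2) x
      ≤ ∫⁻ z, expDecay θ (x + z) ∂ν := by
    by_cases hxa : x ≤ a / 2
    · have e : ENNReal.ofReal (θ * (a / 2)) * ν (Set.Iic (-a)) * lowLevel (a / 2) x
          = ∫⁻ z, Set.indicator (Set.Iic (-a)) (fun _ => ENNReal.ofReal (θ * (a / 2))) z ∂ν := by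
        rw [lintegral_indicator_const measurableSet_Iic]
        simp [lowLevel, hxa]
      rw [e, lindleyOp, ← lintegral_add_right _ (measurable_const.indicator measurableSet_Iic)]
      refine lintegral_mono fun z => ?_
      by_cases hz : z ≤ -a
      · have hmax : max 0 (x + z) = 0 := max_eq_left (by linarith)
        simp only [hmax, expDecay_zero, Set.mem_Iic, hz, Set.indicator_of_mem]
        unfold expDecay
        rw [← ENNReal.ofReal_one, ← ENNReal.ofReal_add zero_le_one
          (mul_nonneg hθ (by linarith))]
        apply ENNReal.ofReal_le_ofReal
        nlinarith [Real.add_one_le_exp (-(θ * (x + z)))]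
      · simp only [Set.mem_Iic, hz, not_false_eq_true, Set.indicator_of_notMem, add_zero]
        exact antitone_expDecay hθ (le_max_right _ _)
    · simp only [lowLevel, Set.mem_Iic, hxa, not_false_eq_true, Set.indicator_of_notMem, mul_zero,
        add_zero]
      exact lintegral_mono fun z => antitone_expDecay hθ (le_max_right _ _)
  refine h1.trans ?_
  rw [lintegral_expDecay_shift]
  calc _ ≤ ENNReal.ofReal (1 + ε) * expDecay θ x := by gcongr
    _ = expDecay θ x + ENNReal.ofReal ε * expDecay θ x := by
        rw [ENNReal.ofReal_add zero_le_one hε, add_mul]; simp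
    _ ≤ expDecay θ x + ENNReal.ofReal ε * 1 := by
        gcongr; exact expDecay_le_one hθ hx
    _ = _ := by rw [mul_one]

lemma iterate_expDecay_add_lowLevel_le [IsProbabilityMeasure ν] {θ a ε : ℝ} (hθ : 0 ≤ θ)
    (hε : 0 ≤ ε) (hR : ∫⁻ z, expDecay θ z ∂ν ≤ ENNReal.ofReal (1 + ε)) (n : ℕ) {x : ℝ}
    (hx : 0 ≤ x) :
    (lindleyOp ν)^[n + 1] (expDecay θ) x
      + ENNReal.ofReal (θ * (a / 2)) * ν (Set.Iic (-a)) * (lindleyOp ν)^[n] (lowLevel (a / 2)) x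
      ≤ (lindleyOp ν)^[n] (expDecay θ) x + ENNReal.ofReal ε := by
  induction n generalizing x with
  | zero => exact expDecay_add_lowLevel_le hθ hε hR hx
  | succ n ih =>
    set c := ENNReal.ofReal (θ * (a / 2)) * ν (Set.Iic (-a))
    have hc : c ≠ ∞ := ENNReal.mul_ne_top ENNReal.ofReal_ne_top (measure_ne_top _ _)
    have hm : ∀ {f : ℝ → ℝ≥0∞}, Antitone f → Measurable fun z : ℝ => f (max 0 (x + z)) :=
      fun hf => hf.measurable.comp (by fun_prop)
    have hF := antitone_iterate (ν := ν) (antitone_expDecay hθ)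
    simp only [Function.iterate_succ_apply' _ _ (lowLevel _), Function.iterate_succ_apply' _ (n + 1),
      Function.iterate_succ_apply' _ n (expDecay θ)] at ih ⊢
    calc _ = lindleyOp ν (fun y => lindleyOp ν ((lindleyOp ν)^[n] (expDecay θ)) y
            + c * (lindleyOp ν)^[n] (lowLevel (a / 2)) y) x := by
          unfold lindleyOp
          rw [← lintegral_const_mul' _ _ hc, ← lintegral_add_left]
          exact hm (antitone (hF n))
      _ ≤ lindleyOp ν (fun y => (lindleyOp ν)^[n] (expDecay θ) y + ENNReal.ofReal ε) x :=
          le_of_le_on_nonneg (fun y hy => ih hy) x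
      _ = _ := by
          rw [lindleyOp, lintegral_add_left (hm (hF n)), lintegral_const, measure_univ, mul_one]
          rfl

/-- The drift inequality telescopes over `n` steps. Each of the `n` occupation terms is at least the
last one, because the walk from 0 is stochastically increasing. -/
lemma nat_mul_iterate_lowLevel_le [IsProbabilityMeasure ν] {θ a ε : ℝ} (hθ : 0 ≤ θ)
    (hε : 0 ≤ ε) (hR : ∫⁻ z, expDecay θ z ∂ν ≤ ENNReal.ofReal (1 + ε)) (n : ℕ) :
    n * (ENNReal.ofReal (θ * (a / 2)) * ν (Set.Iic (-a)) *
      (lindleyOp ν)^[n] (lowLevel (a / 2)) 0) ≤ 1 + n * ENNReal.ofReal ε := by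
  set c := ENNReal.ofReal (θ * (a / 2)) * ν (Set.Iic (-a))
  have tele : (lindleyOp ν)^[n] (expDecay θ) 0
      + ∑ k ∈ Finset.range n, c * (lindleyOp ν)^[k] (lowLevel (a / 2)) 0
      ≤ 1 + n * ENNReal.ofReal ε := by
    induction n with
    | zero => simp [expDecay_zero]
    | succ n ih =>
      rw [Finset.sum_range_succ]
      have h := iterate_expDecay_add_lowLevel_le (a := a) hθ hε hR n le_rfl
      calc _ = ((lindleyOp ν)^[n + 1] (expDecay θ) 0 + c * (lindleyOp ν)^[n] (lowLevel (a / 2)) 0)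
            + ∑ k ∈ Finset.range n, c * (lindleyOp ν)^[k] (lowLevel (a / 2)) 0 := by ring
        _ ≤ ((lindleyOp ν)^[n] (expDecay θ) 0 + ENNReal.ofReal ε)
            + ∑ k ∈ Finset.range n, c * (lindleyOp ν)^[k] (lowLevel (a / 2)) 0 := by gcongr
        _ = ((lindleyOp ν)^[n] (expDecay θ) 0
            + ∑ k ∈ Finset.range n, c * (lindleyOp ν)^[k] (lowLevel (a / 2)) 0)
            + ENNReal.ofReal ε := by ring
        _ ≤ (1 + n * ENNReal.ofReal ε) + ENNReal.ofReal ε := by gcongr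
        _ = _ := by push_cast; ring
  refine le_trans ?_ (le_add_self.trans tele)
  rw [← nsmul_eq_mul, ← Finset.card_range n, ← Finset.sum_const, Finset.card_range]
  refine Finset.sum_le_sum fun k hk => ?_
  gcongr
  exact antitone_iterate_zero (antitone_lowLevel _) (Finset.mem_range.1 hk).le

lemma iterate_lowLevel_le_one [IsProbabilityMeasure ν] (K : ℝ) (n : ℕ) :
    (lindleyOp ν)^[n] (lowLevel K) 0 ≤ 1 := by
  refine (antitone_iterate_zero (antitone_lowLevel _) (Nat.zero_le n)).trans ?_
  exact Set.indicator_le_self' (by simp) _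

lemma tendsto_iterate_lowLevel_half [IsProbabilityMeasure ν] {a C θ₀ : ℝ} (ha : 0 < a)
    (hq : ν (Set.Iic (-a)) ≠ 0) (hC : 0 ≤ C) (hθ₀ : 0 < θ₀)
    (hR : ∀ θ, 0 < θ → θ ≤ θ₀ → ∫⁻ z, expDecay θ z ∂ν ≤ ENNReal.ofReal (1 + C * θ ^ 2)) :
    Tendsto (fun n : ℕ => (lindleyOp ν)^[n] (lowLevel (a / 2)) 0) atTop (𝓝 0) := by
  set q := (ν (Set.Iic (-a))).toReal with hqdef
  have hqpos : 0 < q := ENNReal.toReal_pos hq (measure_ne_top _ _)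
  have hsq : Tendsto (fun n : ℕ => (√(n : ℝ))⁻¹) atTop (𝓝 0) :=
    (Real.tendsto_sqrt_atTop.comp tendsto_natCast_atTop_atTop).inv_tendsto_atTop
  have hb : Tendsto (fun n : ℕ => ENNReal.ofReal ((1 + C) / (a / 2 * q) * (√(n : ℝ))⁻¹)) atTop
      (𝓝 0) := by
    rw [← ENNReal.ofReal_zero, ← mul_zero ((1 + C) / (a / 2 * q))]
    exact ENNReal.tendsto_ofReal (hsq.const_mul _)
  refine tendsto_of_tendsto_of_tendsto_of_le_of_le' tendsto_const_nhds hb (by simp) ?_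
  filter_upwards [hsq.eventually (ge_mem_nhds hθ₀), eventually_gt_atTop 0] with n hn hn0
  have hnpos : (0 : ℝ) < √(n : ℝ) := Real.sqrt_pos.2 (by exact_mod_cast hn0)
  -- The choice `θ = 1/√n` balances the terms `1/θ` and `nCθ` in the bound on the occupation time.
  have h := nat_mul_iterate_lowLevel_le (a := a) (inv_nonneg.2 hnpos.le) (by positivity)
    (hR _ (inv_pos.2 hnpos) hn) n
  set p := (lindleyOp ν)^[n] (lowLevel (a / 2)) 0
  have hp : p ≠ ∞ := ((iterate_lowLevel_le_one _ _).trans_lt ENNReal.one_lt_top).ne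
  rw [← ENNReal.ofReal_toReal hp]
  apply ENNReal.ofReal_le_ofReal
  have h' := ENNReal.toReal_mono (by finiteness) h
  rw [ENNReal.toReal_add (by simp) (by finiteness)] at h'
  simp only [ENNReal.toReal_mul, ENNReal.toReal_natCast, ENNReal.toReal_one] at h'
  rw [ENNReal.toReal_ofReal (by positivity), ENNReal.toReal_ofReal (by positivity), ← hqdef] at h'
  have hs : √(n : ℝ) ^ 2 = n := Real.sq_sqrt (by positivity)
  rw [show (n : ℝ) = √(n : ℝ) ^ 2 from hs.symm, Real.sqrt_sq hnpos.le] at h'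
  generalize √(n : ℝ) = s at *
  have e1 : s ^ 2 * (C * s⁻¹ ^ 2) = C := by field_simp
  have e2 : s ^ 2 * (s⁻¹ * (a / 2) * q * p.toReal) = s * (a / 2 * q) * p.toReal := by field_simp
  rw [e1, e2] at h'
  rw [← div_eq_mul_inv, div_div, le_div_iff₀ (by positivity)]
  linarith

/-- One step below `-a` leads from `[0, K + a]` into `[0, K]`. Hence convergence at level `K`
carries over to `K + a`, and repetition reaches every level. -/
lemma mul_lowLevel_add_le {a K : ℝ} (hK : 0 ≤ K) (x : ℝ) :
    ν (Set.Iic (-a)) * lowLevel (K + a) x ≤ lindleyOp ν (lowLevel K) x := by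
  by_cases hx : x ≤ K + a
  · simp only [lowLevel, Set.mem_Iic, hx, Set.indicator_of_mem, Pi.one_apply, mul_one]
    rw [← lintegral_indicator_one measurableSet_Iic]
    refine lintegral_mono fun z => ?_
    by_cases hz : z ≤ -a
    · have : max 0 (x + z) ≤ K := max_le hK (by linarith)
      simp [hz, this]
    · simp [hz]
  · simp [lowLevel, hx]

/-- The reflected walk leaves every bounded set in probability when its drift is nonnegative up to
second order and its steps fall below `-a` with positive probability. -/
theorem tendsto_iterate_lowLevel [IsProbabilityMeasure ν] {a C θ₀ : ℝ} (ha : 0 < a)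
    (hq : ν (Set.Iic (-a)) ≠ 0) (hC : 0 ≤ C) (hθ₀ : 0 < θ₀)
    (hR : ∀ θ, 0 < θ → θ ≤ θ₀ → ∫⁻ z, expDecay θ z ∂ν ≤ ENNReal.ofReal (1 + C * θ ^ 2)) (K : ℝ) :
    Tendsto (fun n : ℕ => (lindleyOp ν)^[n] (lowLevel K) 0) atTop (𝓝 0) := by
  have key : ∀ j : ℕ,
      Tendsto (fun n : ℕ => (lindleyOp ν)^[n] (lowLevel (a / 2 + j * a)) 0) atTop (𝓝 0) := by
    intro j
    induction j with
    | zero => simpa using tendsto_iterate_lowLevel_half ha hq hC hθ₀ hR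
    | succ j ih =>
      have hqt : ν (Set.Iic (-a)) ≠ ∞ := measure_ne_top _ _
      have h : Tendsto (fun n : ℕ => (ν (Set.Iic (-a)))⁻¹ *
          (lindleyOp ν)^[n + 1] (lowLevel (a / 2 + j * a)) 0) atTop (𝓝 0) := by
        rw [← mul_zero (ν (Set.Iic (-a)))⁻¹]
        exact ENNReal.Tendsto.const_mul ((tendsto_add_atTop_iff_nat 1).2 ih)
          (Or.inr (ENNReal.inv_ne_top.2 hq))
      refine tendsto_of_tendsto_of_tendsto_of_le_of_le tendsto_const_nhds h (by intro; simp) ?_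
      intro n
      have h1 := (monotone (ν := ν)).iterate n
        (fun x => mul_lowLevel_add_le (ν := ν) (a := a) (K := a / 2 + j * a) (by positivity) x) 0
      rw [iterate_const_mul hqt, ← Function.iterate_succ_apply] at h1
      have h2 : a / 2 + ((j + 1 : ℕ) : ℝ) * a = a / 2 + j * a + a := by push_cast; ring
      simp only [h2]
      rw [mul_comm (_)⁻¹, ← div_eq_mul_inv, ENNReal.le_div_iff_mul_le (Or.inl hq) (Or.inl hqt),
        mul_comm ((lindleyOp ν)^[n] _ 0)]
      exact h1
  obtain ⟨j, hj⟩ := exists_nat_ge (K / a)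
  refine tendsto_of_tendsto_of_tendsto_of_le_of_le tendsto_const_nhds (key j) (by intro; simp) ?_
  intro n
  refine monotone.iterate n (fun x => ?_) 0
  have : K ≤ a / 2 + j * a := by
    rw [div_le_iff₀ ha] at hj; linarith
  exact Set.indicator_le_indicator_of_subset (Set.Iic_subset_Iic.2 this) (by intro; simp) x

end lindleyOp

end

/-! ### The reflected walk along paths, and its occupation times. -/

noncomputable section

/-- The walk with steps `z 0, z 1, …`, started at `0` and reflected at `0`, after `k` steps. -/
def lindley : ℕ → (ℕ → ℝ) → ℝ
  | 0, _ => 0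
  | k + 1, z => max 0 (lindley k z + z k)

lemma measurable_lindley (k : ℕ) : Measurable (lindley k) := by
  induction k with
  | zero => exact measurable_const
  | succ k ih => exact measurable_const.max (ih.add (measurable_pi_apply k))

lemma dependsOn_lindley (k : ℕ) : DependsOn (lindley k) (Finset.range k : Set ℕ) := by
  induction k with
  | zero => intro x y _; rfl
  | succ k ih =>
    intro x y h
    have h1 : lindley k x = lindley k y := ih fun i hi => h i (by
      simp only [Finset.coe_range, Set.mem_Iio] at hi ⊢; omega)
    simp only [lindley, h1, h k (by simp)]

/-- A nonnegative process whose increments dominate `z` stays above the reflected walk. -/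
lemma lindley_le {b z : ℕ → ℝ} (hb : ∀ i, 0 ≤ b i) (h : ∀ i, b i + z i ≤ b (i + 1)) (i k : ℕ) :
    lindley k (fun j => z (i + j)) ≤ b (i + k) := by
  induction k with
  | zero => exact hb _
  | succ k ih => exact max_le (hb _) ((add_le_add_left ih _).trans (h (i + k)))

section Independence

variable {Ω : Type*} [MeasurableSpace Ω] {μ : Measure Ω} {ζ : ℕ → Ω → ℝ}

lemma ProbabilityTheory.iIndepFun.indepFun_of_dependsOn (h : iIndepFun ζ μ)
    (hm : ∀ i, Measurable (ζ i)) {S T : Finset ℕ} (hST : Disjoint S T) {F G : (ℕ → ℝ) → ℝ}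
    (hF : Measurable F) (hG : Measurable G) (hFS : DependsOn F (S : Set ℕ))
    (hGT : DependsOn G (T : Set ℕ)) :
    IndepFun (fun ω => F fun i => ζ i ω) (fun ω => G fun i => ζ i ω) μ := by
  classical
  -- The filler 0 is immaterial: `F` and `G` see only the coordinates in `S` and `T`, so both factor
  -- through finite restrictions.
  let ext (U : Finset ℕ) (x : U → ℝ) (i : ℕ) : ℝ := if hi : i ∈ U then x ⟨i, hi⟩ else 0
  have hext : ∀ U, Measurable (ext U) := fun U => measurable_pi_lambda _ fun i => by
    by_cases hi : i ∈ U
    · simpa [ext, hi] using measurable_pi_apply _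
    · simp [ext, hi]
  have key := (h.indepFun_finset S T hST hm).comp (hF.comp (hext S)) (hG.comp (hext T))
  convert key using 1
  · funext ω
    exact hFS fun i hi => by simp [ext, Finset.mem_coe.1 hi]
  · funext ω
    exact hGT fun i hi => by simp [ext, Finset.mem_coe.1 hi]

variable {ν : Measure ℝ}

lemma identDistrib_shift (hm : ∀ i, Measurable (ζ i)) (hi : iIndepFun ζ μ)
    (hl : ∀ i, μ.map (ζ i) = ν) (i i' : ℕ) :
    IdentDistrib (fun ω j => ζ (i + j) ω) (fun ω j => ζ (i' + j) ω) μ μ where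
  aemeasurable_fst := (measurable_pi_lambda _ fun j => hm _).aemeasurable
  aemeasurable_snd := (measurable_pi_lambda _ fun j => hm _).aemeasurable
  map_eq := by
    rw [(hi.precomp (add_right_injective i)).map_fun_eq_infinitePi_map (fun j => hm _),
      (hi.precomp (add_right_injective i')).map_fun_eq_infinitePi_map (fun j => hm _)]
    simp only [hl]

variable [IsProbabilityMeasure μ]

/-- The last step is integrated out first, by its independence of the past; this turns `f` into
`lindleyOp ν f`, still antitone, to which the induction hypothesis applies. -/
lemma lintegral_lindley {f : ℝ → ℝ≥0∞} (hm : ∀ i, Measurable (ζ i)) (hi : iIndepFun ζ μ)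
    (hl : ∀ i, μ.map (ζ i) = ν) (hf : Antitone f) (k : ℕ) :
    ∫⁻ ω, f (lindley k fun j => ζ j ω) ∂μ = (lindleyOp ν)^[k] f 0 := by
  induction k generalizing f with
  | zero => simp [lindley]
  | succ k ih =>
    have hν : IsProbabilityMeasure ν := hl 0 ▸ Measure.isProbabilityMeasure_map (hm 0).aemeasurable
    have hz : Measurable fun ω j => ζ j ω := measurable_pi_lambda _ hm
    have hL : Measurable fun ω => lindley k fun j => ζ j ω := (measurable_lindley k).comp hz
    have hind : IndepFun (fun ω => lindley k fun j => ζ j ω) (ζ k) μ :=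
      hi.indepFun_of_dependsOn hm (S := Finset.range k) (T := {k}) (by simp)
        (measurable_lindley k) (measurable_pi_apply k) (dependsOn_lindley k)
        (fun x y h => h k (by simp))
    have hmap := (indepFun_iff_map_prod_eq_prod_map_map hL.aemeasurable (hm k).aemeasurable).1 hind
    have hP : IsProbabilityMeasure (μ.map fun ω => lindley k fun j => ζ j ω) :=
      Measure.isProbabilityMeasure_map hL.aemeasurable
    have hg : Measurable fun p : ℝ × ℝ => f (max 0 (p.1 + p.2)) :=
      hf.measurable.comp (by fun_prop)
    rw [Function.iterate_succ_apply, ← ih (lindleyOp.antitone hf)]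
    calc ∫⁻ ω, f (max 0 ((lindley k fun j => ζ j ω) + ζ k ω)) ∂μ
        = ∫⁻ p, f (max 0 (p.1 + p.2)) ∂(μ.map fun ω => (lindley k fun j => ζ j ω, ζ k ω)) :=
          (lintegral_map hg (hL.prodMk (hm k))).symm
      _ = ∫⁻ x, lindleyOp ν f x ∂(μ.map fun ω => lindley k fun j => ζ j ω) := by
          rw [hmap, hl k, lintegral_prod _ hg.aemeasurable]; rfl
      _ = _ := lintegral_map (lindleyOp.antitone hf).measurable hL

lemma measure_lindley_le (hm : ∀ i, Measurable (ζ i)) (hi : iIndepFun ζ μ)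
    (hl : ∀ i, μ.map (ζ i) = ν) (K : ℝ) (i k : ℕ) :
    μ {ω | (lindley k fun j => ζ (i + j) ω) ≤ K} = (lindleyOp ν)^[k] (lowLevel K) 0 := by
  have hL : Measurable fun ω => lindley k fun j => ζ (i + j) ω :=
    (measurable_lindley k).comp (measurable_pi_lambda _ fun j => hm _)
  rw [← lintegral_lindley (ζ := fun j => ζ (i + j)) (fun j => hm _)
    (hi.precomp (add_right_injective i)) (fun j => hl _) (antitone_lowLevel K),
    ← lintegral_indicator_one (measurableSet_le hL measurable_const)]
  rfl

/-- Strong law for the occupation of low levels by reflected walks of length `k` started at the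
times of one residue class modulo `k`. -/
lemma ae_tendsto_average_residue (hm : ∀ i, Measurable (ζ i)) (hi : iIndepFun ζ μ)
    (hl : ∀ i, μ.map (ζ i) = ν) (K : ℝ) {k : ℕ} (r : ℕ) :
    ∀ᵐ ω ∂μ, Tendsto (fun m : ℕ => (∑ j ∈ Finset.range m,
      Set.indicator (Set.Iic K) (1 : ℝ → ℝ) (lindley k fun l => ζ (k * j + r + l) ω)) / (m : ℝ))
      atTop (𝓝 ((lindleyOp ν)^[k] (lowLevel K) 0).toReal) := by
  have hind : Measurable (Set.indicator (Set.Iic K) (1 : ℝ → ℝ)) :=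
    measurable_one.indicator measurableSet_Iic
  have hL : ∀ i, Measurable fun ω => lindley k fun l => ζ (i + l) ω := fun i =>
    (measurable_lindley k).comp (measurable_pi_lambda _ fun j => hm _)
  have key := strong_law_ae_real (μ := μ) (fun j ω =>
      Set.indicator (Set.Iic K) (1 : ℝ → ℝ) (lindley k fun l => ζ (k * j + r + l) ω)) ?_ ?_ ?_
  · have e : ∫ ω, Set.indicator (Set.Iic K) (1 : ℝ → ℝ) (lindley k fun l => ζ (k * 0 + r + l) ω) ∂μ
        = ((lindleyOp ν)^[k] (lowLevel K) 0).toReal := by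
      rw [← measure_lindley_le hm hi hl K (k * 0 + r) k, ← measureReal_def,
        ← integral_indicator_one (measurableSet_le (hL _) measurable_const)]
      rfl
    rw [e] at key
    exact key
  · refine Integrable.of_bound ((hind.comp (hL _)).aestronglyMeasurable) 1 (ae_of_all _ fun ω => ?_)
    simp only [Set.indicator]
    split_ifs <;> simp
  · intro a b hab
    let F (j : ℕ) (z : ℕ → ℝ) : ℝ :=
      Set.indicator (Set.Iic K) (1 : ℝ → ℝ) (lindley k fun l => z (k * j + r + l))
    have hF : ∀ j, Measurable (F j) := fun j => hind.comp ((measurable_lindley k).comp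
      (measurable_pi_lambda _ fun l => measurable_pi_apply _))
    -- The `j`-th walk uses only the `k` steps from time `k * j + r` on; these blocks are disjoint
    -- for different `j`.
    have hdep : ∀ j, DependsOn (F j)
        (Finset.Ico (k * j + r) (k * (j + 1) + r) : Finset ℕ) := by
      intro j x y h
      have : (lindley k fun l => x (k * j + r + l)) = lindley k fun l => y (k * j + r + l) :=
        dependsOn_lindley k fun l hl' => h _ (by
          simp only [Finset.coe_range, Set.mem_Iio] at hl'
          simp only [Finset.coe_Ico, Set.mem_Ico, mul_add]
          omega)
      simp only [F, this]
    have hdisj : ∀ {a b : ℕ}, a < b → Disjoint (Finset.Ico (k * a + r) (k * (a + 1) + r))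
        (Finset.Ico (k * b + r) (k * (b + 1) + r)) := by
      intro a b h
      rw [Finset.disjoint_left]
      intro x hx hx'
      simp only [Finset.mem_Ico] at hx hx'
      have := Nat.mul_le_mul_left k (Nat.succ_le_of_lt h)
      simp only [Nat.succ_eq_add_one] at this
      omega
    refine hi.indepFun_of_dependsOn hm ?_ (hF a) (hF b) (hdep a) (hdep b)
    rcases lt_or_gt_of_ne hab with h | h
    · exact hdisj h
    · exact (hdisj h).symm
  · exact fun j => (identDistrib_shift hm hi hl _ _).comp (hind.comp (measurable_lindley k))

end Independence

lemma sum_range_mul_eq (k m : ℕ) (y : ℕ → ℝ) :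
    ∑ i ∈ Finset.range (k * m), y i
      = ∑ r ∈ Finset.range k, ∑ j ∈ Finset.range m, y (k * j + r) := by
  rw [Finset.sum_comm]
  induction m with
  | zero => simp
  | succ m ih => rw [mul_add, mul_one, Finset.sum_range_add, ih, Finset.sum_range_succ]

/-- If `d (i + k) ≤ y i` and the averages of `y` along every residue class modulo `k` tend to `p`,
then the averages of `d` are eventually below every number larger than `p`. -/
lemma eventually_average_lt {d y : ℕ → ℝ} {k : ℕ} (hk : 0 < k) {p q : ℝ} (hpq : p < q)
    (hd : ∀ i, d i ≤ 1) (hy : ∀ i, 0 ≤ y i) (hdy : ∀ i, d (i + k) ≤ y i)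
    (h : ∀ r, Tendsto (fun m : ℕ => (∑ j ∈ Finset.range m, y (k * j + r)) / (m : ℝ)) atTop (𝓝 p)) :
    ∀ᶠ n : ℕ in atTop, (∑ i ∈ Finset.range n, d i) / (n : ℝ) < q := by
  have hk' : (0 : ℝ) < k := by exact_mod_cast hk
  set A : ℕ → ℝ := fun m => (∑ i ∈ Finset.range (k * m), y i) / (m : ℝ)
  have hA : Tendsto A atTop (𝓝 (k * p)) := by
    have := tendsto_finsetSum (Finset.range k) fun r _ => h r
    simp only [Finset.sum_const, Finset.card_range, nsmul_eq_mul] at this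
    refine this.congr fun m => ?_
    simp only [A, sum_range_mul_eq, Finset.sum_div]
  -- `n / k + 1` periods of length `k` suffice to cover the first `n` indices.
  have hm : Tendsto (fun n : ℕ => n / k + 1) atTop atTop :=
    (tendsto_add_atTop_nat 1).comp (Nat.tendsto_div_const_atTop hk.ne')
  have hinv := tendsto_inv_atTop_nhds_zero_nat (𝕜 := ℝ)
  have hlim : Tendsto (fun n : ℕ => (k : ℝ) * (n : ℝ)⁻¹
      + ((k : ℝ)⁻¹ + (n : ℝ)⁻¹) * A (n / k + 1)) atTop (𝓝 p) := by
    have := (hinv.const_mul (k : ℝ)).add ((hinv.const_add (k : ℝ)⁻¹).mul (hA.comp hm))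
    have e : (k : ℝ) * 0 + ((k : ℝ)⁻¹ + 0) * (k * p) = p := by field_simp; ring
    rwa [e] at this
  filter_upwards [hlim.eventually (gt_mem_nhds hpq), eventually_gt_atTop 0] with n hn hn0
  refine lt_of_le_of_lt ?_ hn
  have hn' : (0 : ℝ) < n := by exact_mod_cast hn0
  set m := n / k + 1 with hmdef
  have hm0 : (0 : ℝ) < m := by positivity
  have hnm : n ≤ k * m := by
    have := Nat.div_add_mod n k
    have := Nat.mod_lt n hk
    rw [hmdef, mul_add]; omega
  have hsum : ∑ i ∈ Finset.range n, d i ≤ k + ∑ i ∈ Finset.range (k * m), y i := by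
    have h1 : ∑ i ∈ Finset.range n, d i ≤ ∑ i ∈ Finset.range n, max (d i) 0 :=
      Finset.sum_le_sum fun i _ => le_max_left _ _
    -- The first `k` terms of `d` have no `y` to bound them and cost at most `k`. Positive parts
    -- allow the range to be enlarged.
    have h2 : ∑ i ∈ Finset.range n, max (d i) 0 ≤ ∑ i ∈ Finset.range (k + k * m), max (d i) 0 :=
      Finset.sum_le_sum_of_subset_of_nonneg (Finset.range_mono (by omega))
        fun i _ _ => le_max_right _ _
    have h3 : ∑ i ∈ Finset.range k, max (d i) 0 ≤ k := by
      calc _ ≤ ∑ i ∈ Finset.range k, (1 : ℝ) :=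
            Finset.sum_le_sum fun i _ => max_le (hd i) zero_le_one
        _ = k := by simp
    have h4 : ∑ i ∈ Finset.range (k * m), max (d (k + i)) 0 ≤ ∑ i ∈ Finset.range (k * m), y i :=
      Finset.sum_le_sum fun i _ => max_le (by rw [add_comm]; exact hdy i) (hy i)
    rw [Finset.sum_range_add] at h2
    linarith
  have hmle : (m : ℝ) / n ≤ (k : ℝ)⁻¹ + (n : ℝ)⁻¹ := by
    have h1 : ((n / k : ℕ) : ℝ) ≤ n / k := Nat.cast_div_le
    rw [div_le_iff₀ hn', add_mul, inv_mul_cancel₀ hn'.ne', hmdef]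
    push_cast
    rw [inv_mul_eq_div]
    linarith
  have hAm : 0 ≤ A m := div_nonneg (Finset.sum_nonneg fun i _ => hy i) hm0.le
  calc _ ≤ (k + ∑ i ∈ Finset.range (k * m), y i) / (n : ℝ) := by gcongr
    _ = (k : ℝ) * (n : ℝ)⁻¹ + (m : ℝ) / n * A m := by
        simp only [A]; field_simp
    _ ≤ _ := by gcongr

/-- A nonnegative process whose increments dominate an i.i.d. sequence spends a vanishing fraction
of time below `K`, if the reflected walk with these increments tends to infinity in probability. -/
theorem ae_tendsto_average_zero {Ω : Type*} [MeasurableSpace Ω] {μ : Measure Ω}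
    [IsProbabilityMeasure μ] {ζ : ℕ → Ω → ℝ} {ν : Measure ℝ} [IsProbabilityMeasure ν]
    (hm : ∀ i, Measurable (ζ i)) (hi : iIndepFun ζ μ) (hl : ∀ i, μ.map (ζ i) = ν)
    {K : ℝ} (hν : Tendsto (fun n : ℕ => (lindleyOp ν)^[n] (lowLevel K) 0) atTop (𝓝 0))
    {B : ℕ → Ω → ℝ} (hB : ∀ᵐ ω ∂μ, ∀ i, 0 ≤ B i ω)
    (hstep : ∀ᵐ ω ∂μ, ∀ i, B i ω + ζ i ω ≤ B (i + 1) ω) :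
    ∀ᵐ ω ∂μ, Tendsto (fun n : ℕ => (∑ i ∈ Finset.range n,
      Set.indicator (Set.Iic K) (1 : ℝ → ℝ) (B i ω)) / (n : ℝ)) atTop (𝓝 0) := by
  have hall : ∀ᵐ ω ∂μ, ∀ k r : ℕ, Tendsto (fun m : ℕ => (∑ j ∈ Finset.range m,
      Set.indicator (Set.Iic K) (1 : ℝ → ℝ) (lindley k fun l => ζ (k * j + r + l) ω)) / (m : ℝ))
      atTop (𝓝 ((lindleyOp ν)^[k] (lowLevel K) 0).toReal) :=
    ae_all_iff.2 fun k => ae_all_iff.2 fun r => ae_tendsto_average_residue hm hi hl K r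
  filter_upwards [hall, hB, hstep] with ω hω hBω hsω
  have h0 : ∀ x, 0 ≤ Set.indicator (Set.Iic K) (1 : ℝ → ℝ) x :=
    fun x => Set.indicator_nonneg (by simp) x
  refine tendsto_order.2 ⟨fun q hq => Eventually.of_forall fun n =>
    hq.trans_le (div_nonneg (Finset.sum_nonneg fun i _ => h0 _) (Nat.cast_nonneg _)), ?_⟩
  intro q hq
  have hreal := (ENNReal.tendsto_toReal ENNReal.zero_ne_top).comp hν
  obtain ⟨k, hkq, hk⟩ := ((hreal.eventually (gt_mem_nhds hq)).and (eventually_gt_atTop 0)).exists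
  refine eventually_average_lt
    (y := fun i => Set.indicator (Set.Iic K) 1 (lindley k fun l => ζ (i + l) ω)) hk hkq
    (fun i => Set.indicator_le_self' (by simp) _) (fun i => h0 _) (fun i => ?_) (hω k)
  have hle := lindley_le (z := fun i => ζ i ω) hBω hsω i k
  simp only [Set.indicator, Set.mem_Iic, Pi.one_apply]
  split_ifs with h1 h2
  · exact le_rfl
  · exact absurd (hle.trans h1) h2
  · exact zero_le_one
  · exact le_rfl

end

/-! ### The law of one slot and the probability of an active slot. -/

noncomputable section

section Exponential

lemma expMeasure_Iic {r : ℝ} (hr : 0 < r) {x : ℝ} (hx : 0 ≤ x) :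
    expMeasure r (Set.Iic x) = ENNReal.ofReal (1 - Real.exp (-(r * x))) := by
  have := isProbabilityMeasure_expMeasure hr
  rw [← ofReal_cdf, cdf_expMeasure_eq hr, if_pos hx]

lemma expMeasure_absolutelyContinuous (r : ℝ) : expMeasure r ≪ volume :=
  withDensity_absolutelyContinuous _ _

lemma expMeasure_Iio {r : ℝ} (hr : 0 < r) {x : ℝ} (hx : 0 ≤ x) :
    expMeasure r (Set.Iio x) = ENNReal.ofReal (1 - Real.exp (-(r * x))) := by
  rw [← expMeasure_Iic hr hx]
  exact measure_congr ((expMeasure_absolutelyContinuous r).ae_eq Iio_ae_eq_Iic)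

lemma expMeasure_Ici {r : ℝ} (hr : 0 < r) {x : ℝ} (hx : 0 ≤ x) :
    expMeasure r (Set.Ici x) = ENNReal.ofReal (Real.exp (-(r * x))) := by
  have := isProbabilityMeasure_expMeasure hr
  have hle : Real.exp (-(r * x)) ≤ 1 := Real.exp_le_one_iff.2 (by nlinarith)
  rw [← Set.compl_Iio, prob_compl_eq_one_sub measurableSet_Iio, expMeasure_Iio hr hx,
    ← ENNReal.ofReal_one, ← ENNReal.ofReal_sub _ (by linarith), sub_sub_cancel]

/-- The Laplace transform of the exponential distribution. -/
lemma lintegral_expDecay_expMeasure {r θ : ℝ} (hr : 0 < r) (hθ : 0 ≤ θ) :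
    ∫⁻ x, expDecay θ x ∂(expMeasure r) = ENNReal.ofReal (r / (r + θ)) := by
  have hpdf : Measurable (exponentialPDF r) :=
    (measurable_exponentialPDFReal r).ennreal_ofReal
  have h : expMeasure r = volume.withDensity (exponentialPDF r) := rfl
  rw [h, lintegral_withDensity_eq_lintegral_mul _ hpdf (measurable_expDecay θ)]
  -- Exponential tilting: the product is again an exponential density, of rate `r + θ`, up to a
  -- constant.
  have e : ∀ x, (exponentialPDF r * expDecay θ) x
      = ENNReal.ofReal (r / (r + θ)) * exponentialPDF (r + θ) x := by
    intro x
    simp only [Pi.mul_apply, expDecay, exponentialPDF_eq]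
    rw [← ENNReal.ofReal_mul' (Real.exp_pos _).le, ← ENNReal.ofReal_mul (by positivity)]
    congr 1
    split_ifs
    · rw [mul_assoc, ← Real.exp_add, ← mul_assoc, div_mul_cancel₀ _ (by positivity)]
      congr 2; ring
    · simp
  simp_rw [e]
  rw [lintegral_const_mul' _ _ ENNReal.ofReal_ne_top,
    lintegral_exponentialPDF_eq_one (by positivity), mul_one]

end Exponential

namespace R1Network

variable (N : R1Network)

instance : IsProbabilityMeasure (expMeasure N.WSR2) := isProbabilityMeasure_expMeasure N.WSR2_pos
instance : IsProbabilityMeasure (expMeasure N.WR1R2) := isProbabilityMeasure_expMeasure N.WR1R2_pos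
instance : IsProbabilityMeasure (expMeasure N.lam) := isProbabilityMeasure_expMeasure N.lam_pos

/-- The joint law of the conditions of a slot. -/
def condLaw : Measure (Cond → Bool) :=
  Measure.pi fun k => bernoulliMeasure true false (N.prob k)

instance : IsProbabilityMeasure N.condLaw := by unfold condLaw; infer_instance

instance : IsProbabilityMeasure N.slotLaw := by unfold slotLaw; infer_instance

lemma Gth_pos : 0 < N.Gth := by
  have := Real.one_lt_rpow one_lt_two N.R0_pos
  unfold Gth; linarith

/-- The slots in which R1 transmits if its buffer allows it. -/
def activeSet : Set Slot := {s | N.Spends N.M s}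

/-- The cylinder of the condition vectors that agree with `v` on `K`. -/
def condCyl (K : Finset Cond) (v : Cond → Bool) : Set (Cond → Bool) :=
  Set.pi Set.univ fun k => if k ∈ K then {v k} else Set.univ

lemma measurableSet_condCyl (K : Finset Cond) (v : Cond → Bool) : MeasurableSet (condCyl K v) :=
  MeasurableSet.univ_pi fun _ => MeasurableSet.of_discrete

lemma condLaw_condCyl (K : Finset Cond) (v : Cond → Bool) :
    N.condLaw.real (condCyl K v) =
      ∏ k ∈ K, if v k then (N.prob k : ℝ) else 1 - (N.prob k : ℝ) := by
  rw [measureReal_def, condLaw, condCyl, Measure.pi_pi, ENNReal.toReal_prod, ← Finset.prod_subset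
    (Finset.subset_univ K) (by intro k _ hk; simp [hk])]
  refine Finset.prod_congr rfl fun k hk => ?_
  rw [if_pos hk, ← measureReal_def, bernoulliMeasure_real_apply _ MeasurableSet.of_discrete]
  cases v k <;> simp

lemma toMeasure_isAll : N.p.toMeasure.real {t | t.IsAll} =
    (N.p .SR1R2a).toReal + (N.p .SR1R2b).toReal + (N.p .SR1R2c).toReal := by
  classical
  have : {t : TCSet | t.IsAll} = (({.SR1R2a, .SR1R2b, .SR1R2c} : Finset TCSet) : Set TCSet) := by
    ext t; cases t <;> simp [TCSet.IsAll]
  rw [this, measureReal_def, PMF.toMeasure_apply_finset, ENNReal.toReal_sum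
    (fun t _ => PMF.apply_ne_top _ _), Finset.sum_insert (by simp), Finset.sum_insert (by simp),
    Finset.sum_singleton, add_assoc]

/-- The slots with candidate set in `T`, conditions in `V` and link SNRs in `I` and `J`. -/
def slotBox (T : Set TCSet) (V : Set (Cond → Bool)) (I J : Set ℝ) : Set Slot :=
  T ×ˢ V ×ˢ I ×ˢ J ×ˢ Set.univ

lemma slotLaw_slotBox (T : Set TCSet) (V : Set (Cond → Bool)) (I J : Set ℝ) :
    N.slotLaw.real (slotBox T V I J) = N.p.toMeasure.real T * (N.condLaw.real V *
      ((expMeasure N.WSR2).real I * (expMeasure N.WR1R2).real J)) := by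
  unfold slotLaw slotBox
  rw [measureReal_prod_prod, measureReal_prod_prod, measureReal_prod_prod, measureReal_prod_prod]
  simp [condLaw]

lemma measurableSet_slotBox {T : Set TCSet} {V : Set (Cond → Bool)} {I J : Set ℝ}
    (hV : MeasurableSet V) (hI : MeasurableSet I) (hJ : MeasurableSet J) :
    MeasurableSet (slotBox T V I J) :=
  MeasurableSet.of_discrete.prod (hV.prod (hI.prod (hJ.prod MeasurableSet.univ)))

/-- The vector `(· == .C)` prescribes C and not D, `(· != .G)` prescribes E2, O, F and not G, and
`(· == .O)` prescribes O and neither E2 nor G. -/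
lemma activeSet_eq : N.activeSet =
    slotBox {.SR1} (condCyl {.C, .D} (· == .C)) Set.univ Set.univ ∪
    (slotBox {.SR1} (condCyl {.C, .D} fun _ => true) (Set.Iio N.Gth) (Set.Ici N.Gth) ∪
    (slotBox {t | t.IsAll} (condCyl {.E2, .O, .F, .G} (· != .G)) Set.univ Set.univ ∪
    slotBox {t | t.IsAll} (condCyl {.E2, .O, .G} (· == .O)) Set.univ Set.univ)) := by
  have hpi : ∀ K v c, c ∈ condCyl K v ↔ ∀ k ∈ K, c k = v k := by
    intro K v c
    simp only [condCyl, Set.mem_pi, Set.mem_univ, true_imp_iff]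
    refine forall_congr' fun k => ?_
    by_cases hk : k ∈ K <;> simp [hk]
  ext ⟨t, c, y, w, x⟩
  simp only [activeSet, Spends, slotBox, Set.mem_ofPred_eq, Set.mem_union, Set.mem_prod, hpi,
    Slot.tc, Slot.holds, Slot.snrSR2, Slot.snrR1R2, le_refl, true_and, Set.mem_singleton_iff,
    Finset.mem_insert, Finset.mem_singleton, forall_eq_or_imp, forall_eq, Set.mem_univ, and_true,
    Set.mem_Iio, Set.mem_Ici, Bool.not_eq_true]
  simp
  tauto

lemma measurableSet_activeSet : MeasurableSet N.activeSet := by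
  rw [activeSet_eq]
  refine (measurableSet_slotBox ?_ ?_ ?_).union ((measurableSet_slotBox ?_ ?_ ?_).union
    ((measurableSet_slotBox ?_ ?_ ?_).union (measurableSet_slotBox ?_ ?_ ?_)))
  all_goals first | exact measurableSet_condCyl _ _ | measurability

/-- The four boxes are disjoint: D separates the first two, E2 the last two, and the candidate set
separates the pairs. The product law then gives the terms of `b1`. -/
lemma slotLaw_activeSet : N.slotLaw.real N.activeSet = N.b1 := by
  have hbox : ∀ {T K v I J}, MeasurableSet I → MeasurableSet J →
      MeasurableSet (slotBox T (condCyl K v) I J) := fun hI hJ =>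
    measurableSet_slotBox (measurableSet_condCyl _ _) hI hJ
  have hdT : ∀ {V V' I J I' J'}, Disjoint (slotBox {.SR1} V I J)
      (slotBox {t | t.IsAll} V' I' J') := by
    intros
    refine Set.disjoint_prod.2 (Or.inl ?_)
    simp [TCSet.IsAll]
  have hdV : ∀ {T V V' I J I' J'}, Disjoint V V' →
      Disjoint (slotBox T V I J) (slotBox T V' I' J') := fun h =>
    Set.disjoint_prod.2 (Or.inr (Set.disjoint_prod.2 (Or.inl h)))
  have hcyl : ∀ {K K' : Finset Cond} {v v' : Cond → Bool} (k : Cond), k ∈ K → k ∈ K' → v k ≠ v' k →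
      Disjoint (condCyl K v) (condCyl K' v') := by
    intro K K' v v' k hk hk' hne
    rw [Set.disjoint_left]
    intro c hc hc'
    have h1 := hc k trivial
    have h2 := hc' k trivial
    simp only [hk, hk', if_true, Set.mem_singleton_iff] at h1 h2
    exact hne (h1.symm.trans h2)
  rw [activeSet_eq, measureReal_union, measureReal_union, measureReal_union]
  · simp only [slotLaw_slotBox, condLaw_condCyl, toMeasure_isAll]
    simp only [measureReal_def (μ := N.p.toMeasure),
      N.p.toMeasure_apply_singleton _ (MeasurableSet.singleton _)]
    rw [measureReal_def (μ := expMeasure N.WSR2) (s := Set.Iio _),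
      measureReal_def (μ := expMeasure N.WR1R2) (s := Set.Ici _),
      expMeasure_Iio N.WSR2_pos N.Gth_pos.le, expMeasure_Ici N.WR1R2_pos N.Gth_pos.le,
      ENNReal.toReal_ofReal, ENNReal.toReal_ofReal (Real.exp_pos _).le]
    · simp [b1]
      ring
    · have := N.WSR2_pos
      have := N.Gth_pos
      rw [sub_nonneg, Real.exp_le_one_iff]
      simp only [Left.neg_nonpos_iff]
      positivity
  · exact hdV (hcyl .E2 (by simp) (by simp) (by decide))
  · exact hbox MeasurableSet.univ MeasurableSet.univ
  · exact Set.disjoint_union_right.2 ⟨hdT, hdT⟩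
  · exact (hbox MeasurableSet.univ MeasurableSet.univ).union
      (hbox MeasurableSet.univ MeasurableSet.univ)
  · exact Set.disjoint_union_right.2 ⟨hdV (hcyl .D (by simp) (by simp) (by simp)),
      Set.disjoint_union_right.2 ⟨hdT, hdT⟩⟩
  · exact (hbox measurableSet_Iio measurableSet_Ici).union
      ((hbox MeasurableSet.univ MeasurableSet.univ).union
        (hbox MeasurableSet.univ MeasurableSet.univ))

lemma measurable_X : Measurable Slot.X :=
  measurable_snd.comp (measurable_snd.comp (measurable_snd.comp measurable_snd))

/-- The harvested energy is independent of the other slot data. -/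
lemma lintegral_slotLaw_harvest {g : ℝ → ℝ≥0∞} (hg : Measurable g)
    (hgt : ∫⁻ x, g x ∂(expMeasure N.lam) ≠ ∞) {A : Set Slot} (hA : MeasurableSet A)
    (hAX : ∀ t c y w x x', ((t, c, y, w, x) : Slot) ∈ A → ((t, c, y, w, x') : Slot) ∈ A) :
    ∫⁻ s in A, g s.X ∂N.slotLaw = N.slotLaw A * ∫⁻ x, g x ∂(expMeasure N.lam) := by
  have key : ∀ g : ℝ → ℝ≥0∞, Measurable g → ∫⁻ s in A, g s.X ∂N.slotLaw =
      ∫⁻ t, ∫⁻ c, ∫⁻ y, ∫⁻ w, A.indicator 1 ((t, c, y, w, 0) : Slot)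
        * ∫⁻ x, g x ∂(expMeasure N.lam)
        ∂(expMeasure N.WR1R2) ∂(expMeasure N.WSR2) ∂N.condLaw ∂N.p.toMeasure := by
    intro g hg
    have hm : Measurable fun s : Slot => A.indicator 1 s * g s.X :=
      (measurable_one.indicator hA).mul (hg.comp measurable_X)
    have e : ∀ s : Slot, A.indicator (fun s => g s.X) s = A.indicator 1 s * g s.X := by
      intro s; by_cases hs : s ∈ A <;> simp [hs]
    rw [← lintegral_indicator hA]
    simp_rw [e]
    unfold slotLaw
    refine (lintegral_prod _ hm.aemeasurable).trans ?_
    refine lintegral_congr fun t => ?_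
    refine (lintegral_prod _ (hm.comp (g := fun s : Slot => A.indicator 1 s * g s.X)
      (f := fun q : (Cond → Bool) × ℝ × ℝ × ℝ => ((t, q) : Slot)) (by fun_prop)).aemeasurable).trans ?_
    refine lintegral_congr fun c => ?_
    refine (lintegral_prod _ (hm.comp (g := fun s : Slot => A.indicator 1 s * g s.X)
      (f := fun q : ℝ × ℝ × ℝ => ((t, c, q) : Slot)) (by fun_prop)).aemeasurable).trans ?_
    refine lintegral_congr fun y => ?_
    refine (lintegral_prod _ (hm.comp (g := fun s : Slot => A.indicator 1 s * g s.X)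
      (f := fun q : ℝ × ℝ => ((t, c, y, q) : Slot)) (by fun_prop)).aemeasurable).trans ?_
    refine lintegral_congr fun w => ?_
    rw [← lintegral_const_mul _ hg]
    refine lintegral_congr fun x => ?_
    have : A.indicator (1 : Slot → ℝ≥0∞) (t, c, y, w, x) = A.indicator 1 (t, c, y, w, 0) := by
      by_cases h : ((t, c, y, w, x) : Slot) ∈ A
      · simp [h, hAX _ _ _ _ _ 0 h]
      · have h' : ((t, c, y, w, 0) : Slot) ∉ A := fun h0 => h (hAX _ _ _ _ _ x h0)
        simp [h, h']
    exact congrArg (· * g x) this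
  -- With `g = 1` the iterated integral of the indicator is identified as `N.slotLaw A`.
  have h1 := key 1 measurable_one
  simp only [Pi.one_apply, lintegral_const, measure_univ, mul_one, one_mul, Measure.restrict_apply,
    MeasurableSet.univ, Set.univ_inter] at h1
  rw [key g hg, h1]
  simp_rw [lintegral_mul_const' _ _ hgt]

end R1Network
end

/-! ### Drift of the unrestricted increments and comparison with the buffer. -/

noncomputable section

namespace R1Network

variable (N : R1Network)

lemma b1_nonneg : 0 ≤ N.b1 := by rw [← slotLaw_activeSet]; positivity

lemma b1_le_one : N.b1 ≤ 1 := by rw [← slotLaw_activeSet]; exact measureReal_le_one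

lemma psi_nonneg : 0 ≤ N.psi :=
  mul_nonneg (mul_nonneg N.lam_pos.le N.M_pos.le) N.b1_nonneg

/-- The change of the buffer level in the slot `s` when the buffer imposes no restriction. -/
def incr (s : Slot) : ℝ := s.X - N.activeSet.indicator (fun _ => N.M) s

lemma measurable_incr : Measurable N.incr :=
  measurable_X.sub (measurable_const.indicator N.measurableSet_activeSet)

/-- The law of the unrestricted change of the buffer level. -/
def incrLaw : Measure ℝ := N.slotLaw.map N.incr

instance : IsProbabilityMeasure N.incrLaw :=
  Measure.isProbabilityMeasure_map N.measurable_incr.aemeasurable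

lemma Spends.mem_activeSet {N : R1Network} {x : ℝ} {s : Slot} (h : N.Spends x s) :
    s ∈ N.activeSet := by
  simp only [activeSet, Set.mem_ofPred_eq, Spends, le_refl, true_and] at h ⊢
  tauto

lemma Spends.le {N : R1Network} {x : ℝ} {s : Slot} (h : N.Spends x s) : N.M ≤ x := by
  unfold Spends at h
  tauto

/-- The two sides differ only in an active slot whose buffer is too low to transmit; there the true
level keeps the energy `M`. -/
lemma add_incr_le_step (x : ℝ) (s : Slot) : x + N.incr s ≤ N.step x s := by
  unfold step incr
  split_ifs with h
  · rw [Set.indicator_of_mem h.mem_activeSet]; linarith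
  · have : 0 ≤ N.activeSet.indicator (fun _ => N.M) s :=
      Set.indicator_nonneg (fun _ _ => N.M_pos.le) s
    linarith

lemma step_nonneg {x : ℝ} {s : Slot} (hx : 0 ≤ x) (hs : 0 ≤ s.X) : 0 ≤ N.step x s := by
  unfold step
  split_ifs with h
  · linarith [h.le]
  · linarith

lemma ae_harvest_nonneg : ∀ᵐ s ∂N.slotLaw, 0 ≤ s.X := by
  have h := N.lintegral_slotLaw_harvest (g := (Set.Iio 0).indicator 1)
    (measurable_one.indicator measurableSet_Iio)
    (by rw [lintegral_indicator_one measurableSet_Iio]; finiteness)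
    MeasurableSet.univ (fun _ _ _ _ _ _ _ => trivial)
  have h0 : expMeasure N.lam (Set.Iio 0) = 0 := by simp [expMeasure_Iio N.lam_pos le_rfl]
  rw [lintegral_indicator_one measurableSet_Iio, h0, mul_zero, Measure.restrict_univ] at h
  have hm : MeasurableSet {s : Slot | s.X < 0} := measurableSet_lt measurable_X measurable_const
  rw [ae_iff]
  simp only [not_le]
  rw [← lintegral_indicator_one hm]
  exact h

lemma laplace_incrLaw {θ : ℝ} (hθ : 0 ≤ θ) : ∫⁻ z, expDecay θ z ∂N.incrLaw =
    ENNReal.ofReal ((N.b1 * Real.exp (θ * N.M) + (1 - N.b1)) * (N.lam / (N.lam + θ))) := by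
  have hA := N.measurableSet_activeSet
  have hlap := lintegral_expDecay_expMeasure N.lam_pos hθ
  have hfin : ∫⁻ x, expDecay θ x ∂(expMeasure N.lam) ≠ ∞ := by rw [hlap]; finiteness
  have hlam := N.lam_pos
  have hb := N.b1_nonneg
  have hb' := N.b1_le_one
  have h1 : ∫⁻ s in N.activeSet, expDecay θ (N.incr s) ∂N.slotLaw =
      ENNReal.ofReal (Real.exp (θ * N.M)) *
        (ENNReal.ofReal N.b1 * ENNReal.ofReal (N.lam / (N.lam + θ))) := by
    rw [← N.slotLaw_activeSet, ofReal_measureReal, ← hlap,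
      ← N.lintegral_slotLaw_harvest (measurable_expDecay θ) hfin hA (fun _ _ _ _ _ _ h => h),
      ← lintegral_const_mul' _ _ ENNReal.ofReal_ne_top]
    refine setLIntegral_congr_fun hA fun s hs => ?_
    simp only [incr, Set.indicator_of_mem hs, sub_eq_neg_add, expDecay_add]
    simp [expDecay]
  have h2 : ∫⁻ s in N.activeSetᶜ, expDecay θ (N.incr s) ∂N.slotLaw =
      ENNReal.ofReal (1 - N.b1) * ENNReal.ofReal (N.lam / (N.lam + θ)) := by
    rw [← N.slotLaw_activeSet, ← probReal_compl_eq_one_sub hA, ofReal_measureReal, ← hlap,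
      ← N.lintegral_slotLaw_harvest (measurable_expDecay θ) hfin hA.compl
        (fun _ _ _ _ _ _ h => h)]
    refine setLIntegral_congr_fun hA.compl fun s hs => ?_
    simp only [incr, Set.indicator_of_notMem hs, sub_zero]
  rw [incrLaw, lintegral_map (measurable_expDecay θ) N.measurable_incr,
    ← lintegral_add_compl _ hA, h1, h2,
    ← ENNReal.ofReal_mul (by positivity), ← ENNReal.ofReal_mul (by positivity),
    ← ENNReal.ofReal_mul (by linarith), ← ENNReal.ofReal_add (by positivity)
      (mul_nonneg (by linarith) (by positivity))]
  congr 1; ring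

lemma exp_mul_M_le {θ : ℝ} (hθ : 0 ≤ θ) (hθM : θ * N.M ≤ 1) :
    Real.exp (θ * N.M) ≤ 1 + θ * N.M + (θ * N.M) ^ 2 := by
  have hM := N.M_pos
  have := Real.abs_exp_sub_one_sub_id_le (x := θ * N.M) (by rwa [abs_of_nonneg (by positivity)])
  linarith [(abs_le.1 this).2]

lemma laplace_incrLaw_le (hψ : N.psi ≤ 1) {θ : ℝ} (hθ : 0 < θ) (hθM : θ ≤ N.M⁻¹) :
    ∫⁻ z, expDecay θ z ∂N.incrLaw ≤ ENNReal.ofReal (1 + N.M ^ 2 * θ ^ 2) := by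
  rw [laplace_incrLaw N hθ.le]
  apply ENNReal.ofReal_le_ofReal
  have hM := N.M_pos
  have hlam := N.lam_pos
  have hb := N.b1_nonneg
  have hb' := N.b1_le_one
  have hexp := N.exp_mul_M_le hθ.le (by rwa [← le_div_iff₀ hM, one_div])
  rw [← mul_div_assoc, div_le_iff₀ (by positivity)]
  -- The first-order term is `θψ ≤ θ`, which the denominator `λ + θ` absorbs. Only a second-order
  -- remainder is left, bounded through `b1 ≤ 1`.
  have h1 := mul_le_mul_of_nonneg_left hexp hb
  have h2 := mul_le_mul_of_nonneg_right h1 hlam.le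
  have h3 : θ * N.psi ≤ θ * 1 := mul_le_mul_of_nonneg_left hψ hθ.le
  have h4 : N.b1 * ((θ * N.M) ^ 2 * N.lam) ≤ 1 * ((θ * N.M) ^ 2 * N.lam) :=
    mul_le_mul_of_nonneg_right hb' (by positivity)
  have h5 : 0 ≤ θ * (N.M ^ 2 * θ ^ 2) := by positivity
  unfold psi at h3
  nlinarith

lemma exists_laplace_incrLaw_lt_one (hψ : N.psi < 1) :
    ∃ θ, 0 ≤ θ ∧ ∫⁻ z, expDecay θ z ∂N.incrLaw < 1 := by
  have hM := N.M_pos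
  have hlam := N.lam_pos
  have hb := N.b1_nonneg
  have hψ0 := N.psi_nonneg
  -- To second order the transform is below 1 as soon as `ψ(1 + θM) < 1`. This θ turns the condition
  -- into `ψ(2 - ψ) < 1`, that is `(1 - ψ)² > 0`.
  set θ := (1 - N.psi) / N.M
  have hθ : 0 < θ := div_pos (by linarith) hM
  have hθM : θ * N.M = 1 - N.psi := div_mul_cancel₀ _ hM.ne'
  refine ⟨θ, hθ.le, ?_⟩
  rw [laplace_incrLaw N hθ.le, ENNReal.ofReal_lt_one, ← mul_div_assoc, div_lt_one (by positivity)]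
  have hexp := N.exp_mul_M_le hθ.le (by linarith)
  have h2 := mul_le_mul_of_nonneg_right (mul_le_mul_of_nonneg_left hexp hb) hlam.le
  have h3 : N.b1 * (1 + θ * N.M + (θ * N.M) ^ 2) * N.lam
      = N.b1 * N.lam + θ * N.psi * (1 + θ * N.M) := by unfold psi; ring
  rw [h3, hθM] at h2
  rw [hθM]
  have h4 : θ * (N.psi * (2 - N.psi)) < θ * 1 := mul_lt_mul_of_pos_left (by nlinarith) hθ
  nlinarith

/-- An active slot with harvest at most `M/2` lowers the free level by at least `M/2`, and activity
is independent of the harvest. -/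
lemma incrLaw_Iic_ne_zero (hb : N.b1 ≠ 0) : N.incrLaw (Set.Iic (-(N.M / 2))) ≠ 0 := by
  have hM := N.M_pos
  have hlam := N.lam_pos
  have hA := N.measurableSet_activeSet
  have h := N.lintegral_slotLaw_harvest (g := (Set.Iic (N.M / 2)).indicator 1)
    (measurable_one.indicator measurableSet_Iic)
    (by rw [lintegral_indicator_one measurableSet_Iic]; finiteness) hA
    (fun _ _ _ _ _ _ h => h)
  rw [lintegral_indicator_one measurableSet_Iic, expMeasure_Iic hlam (by positivity)] at h
  have hX : MeasurableSet {s : Slot | s.X ≤ N.M / 2} := measurableSet_le measurable_X measurable_const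
  have e : ∫⁻ s in N.activeSet, (Set.Iic (N.M / 2)).indicator (1 : ℝ → ℝ≥0∞) s.X ∂N.slotLaw
      = N.slotLaw ({s | s.X ≤ N.M / 2} ∩ N.activeSet) := by
    rw [← Measure.restrict_apply hX, ← lintegral_indicator_one hX]; rfl
  have hpos : N.slotLaw ({s | s.X ≤ N.M / 2} ∩ N.activeSet) ≠ 0 := by
    rw [← e, h]
    refine mul_ne_zero (fun h0 => hb ?_) ?_
    · rw [← slotLaw_activeSet, measureReal_def, h0, ENNReal.toReal_zero]
    · rw [Ne, ENNReal.ofReal_eq_zero, not_le, sub_pos, Real.exp_lt_one_iff]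
      have : 0 < N.lam * (N.M / 2) := by positivity
      linarith
  rw [incrLaw, Measure.map_apply N.measurable_incr measurableSet_Iic]
  refine fun h0 => hpos (measure_mono_null ?_ h0)
  rintro s ⟨hs, hsA⟩
  simp only [Set.mem_ofPred_eq] at hs
  simp only [Set.mem_preimage, Set.mem_Iic, incr, Set.indicator_of_mem hsA]
  linarith

theorem tendsto_iterate_incrLaw (hψ : N.psi ≤ 1) (K : ℝ) :
    Tendsto (fun n : ℕ => (lindleyOp N.incrLaw)^[n] (lowLevel K) 0) atTop (𝓝 0) := by
  have hM := N.M_pos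
  rcases hψ.lt_or_eq with h | h
  · obtain ⟨θ, hθ, hR⟩ := N.exists_laplace_incrLaw_lt_one h
    have hlim := ENNReal.Tendsto.const_mul (a := ENNReal.ofReal (Real.exp (θ * K)))
      (ENNReal.tendsto_pow_atTop_nhds_zero_of_lt_one hR) (Or.inr ENNReal.ofReal_ne_top)
    rw [mul_zero] at hlim
    exact tendsto_of_tendsto_of_tendsto_of_le_of_le tendsto_const_nhds hlim (fun _ => by simp)
      fun n => lindleyOp.iterate_lowLevel_le hθ hR.ne_top K n
  -- At `ψ = 1` active slots have positive probability, so the downward steps needed by the critical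
  -- argument exist.
  · have hb : N.b1 ≠ 0 := fun hb => by simp [psi, hb] at h
    exact lindleyOp.tendsto_iterate_lowLevel (half_pos hM) (N.incrLaw_Iic_ne_zero hb)
      (sq_nonneg N.M) (inv_pos.2 hM) (fun θ h0 h1 => N.laplace_incrLaw_le hψ h0 h1) K

/-- One buffer update lies above one step of the reflected walk, so invariance becomes an inequality
for decreasing test functions. -/
lemma IsStationary.lintegral_le {N : R1Network} {π : Measure ℝ} (h : N.IsStationary π)
    {f : ℝ → ℝ≥0∞} (hf : Antitone f) : ∫⁻ x, f x ∂π ≤ ∫⁻ x, lindleyOp N.incrLaw f x ∂π := by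
  obtain ⟨hπ, hnn, hst⟩ := h
  calc ∫⁻ x, f x ∂π = ∫⁻ x, f x ∂((π.prod N.slotLaw).map fun z => N.step z.1 z.2) := by rw [hst]
    _ = ∫⁻ x, ∫⁻ s, f (N.step x s) ∂N.slotLaw ∂π := by
        rw [lintegral_map hf.measurable N.measurable_step]
        exact lintegral_prod _ (hf.measurable.comp N.measurable_step).aemeasurable
    _ ≤ ∫⁻ x, ∫⁻ s, f (max 0 (x + N.incr s)) ∂N.slotLaw ∂π := by
        refine lintegral_mono_ae ?_
        filter_upwards [hnn] with x hx
        refine lintegral_mono_ae ?_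
        filter_upwards [N.ae_harvest_nonneg] with s hs
        exact hf (max_le (N.step_nonneg hx hs) (N.add_incr_le_step x s))
    _ = _ := by
        refine lintegral_congr fun x => ?_
        have hg : Measurable fun z : ℝ => f (max 0 (x + z)) := hf.measurable.comp (by fun_prop)
        rw [lindleyOp, incrLaw, lintegral_map hg N.measurable_incr]

theorem not_isStationary (hψ : N.psi ≤ 1) (π : Measure ℝ) : ¬ N.IsStationary π := by
  intro h
  have hπ := h.1
  have hzero : ∀ K : ℝ, π (Set.Iic K) = 0 := by
    intro K
    -- Among nonnegative starting points, 0 is the one most likely to leave the walk below `K`.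
    have hn : ∀ n : ℕ, π (Set.Iic K) ≤ (lindleyOp N.incrLaw)^[n] (lowLevel K) 0 := by
      intro n
      have hanti := fun n => lindleyOp.antitone_iterate (ν := N.incrLaw) (antitone_lowLevel K) n
      have h1 : π (Set.Iic K) ≤ ∫⁻ x, (lindleyOp N.incrLaw)^[n] (lowLevel K) x ∂π := by
        induction n with
        | zero => exact (lintegral_indicator_one measurableSet_Iic).ge
        | succ n ih =>
          rw [Function.iterate_succ_apply']
          exact ih.trans (h.lintegral_le (hanti n))
      refine h1.trans ?_
      calc _ ≤ ∫⁻ _, (lindleyOp N.incrLaw)^[n] (lowLevel K) 0 ∂π := by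
            refine lintegral_mono_ae ?_
            filter_upwards [h.2.1] with x hx
            exact hanti n hx
        _ = _ := by simp
    exact le_antisymm (ge_of_tendsto' (N.tendsto_iterate_incrLaw hψ K) hn) bot_le
  have hU : π (⋃ n : ℕ, Set.Iic (n : ℝ)) = 0 := measure_iUnion_null fun n => hzero n
  have huniv : (⋃ n : ℕ, Set.Iic (n : ℝ)) = Set.univ :=
    Set.eq_univ_of_forall fun x => Set.mem_iUnion.2 (exists_nat_ge x)
  rw [huniv, measure_univ] at hU
  exact one_ne_zero hU

/-! ### The buffer process: convergence in probability, eventual behaviour and time averages. -/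

namespace IsEnergyBuffer

variable {N} {Ω : Type*} [MeasurableSpace Ω] {μ : Measure Ω} {ξ : ℕ → Ω → Slot} {B : ℕ → Ω → ℝ}

lemma measurable (h : N.IsEnergyBuffer μ ξ B) (i : ℕ) : Measurable (B i) := by
  induction i with
  | zero => exact h.measurable_init
  | succ i ih =>
    have e : B (i + 1) = fun ω => N.step (B i ω) (ξ i ω) := funext (h.update i)
    rw [e]
    exact N.measurable_step.comp (ih.prodMk (h.measurable_slot i))

lemma ae_nonneg (h : N.IsEnergyBuffer μ ξ B) : ∀ᵐ ω ∂μ, ∀ i, 0 ≤ B i ω := by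
  have hX : ∀ᵐ ω ∂μ, ∀ i, 0 ≤ (ξ i ω).X := ae_all_iff.2 fun i =>
    ae_of_ae_map (h.measurable_slot i).aemeasurable (by rw [h.law_slot]; exact N.ae_harvest_nonneg)
  filter_upwards [hX] with ω hω i
  induction i with
  | zero => exact h.init_nonneg ω
  | succ i ih => rw [h.update]; exact N.step_nonneg ih (hω i)

lemma add_incr_le (h : N.IsEnergyBuffer μ ξ B) (i : ℕ) (ω : Ω) :
    B i ω + N.incr (ξ i ω) ≤ B (i + 1) ω := by
  rw [h.update]; exact N.add_incr_le_step _ _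

lemma measurable_incr (h : N.IsEnergyBuffer μ ξ B) (i : ℕ) :
    Measurable fun ω => N.incr (ξ i ω) :=
  N.measurable_incr.comp (h.measurable_slot i)

lemma iIndepFun_incr (h : N.IsEnergyBuffer μ ξ B) : iIndepFun (fun i ω => N.incr (ξ i ω)) μ :=
  h.indep_slot.comp (fun _ => N.incr) fun _ => N.measurable_incr

lemma map_incr (h : N.IsEnergyBuffer μ ξ B) (i : ℕ) :
    μ.map (fun ω => N.incr (ξ i ω)) = N.incrLaw := by
  rw [incrLaw, ← h.law_slot i, Measure.map_map N.measurable_incr (h.measurable_slot i)]; rfl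

variable [IsProbabilityMeasure μ]

lemma measure_le (h : N.IsEnergyBuffer μ ξ B) (K : ℝ) (i : ℕ) :
    μ {ω | B i ω ≤ K} ≤ (lindleyOp N.incrLaw)^[i] (lowLevel K) 0 := by
  rw [← measure_lindley_le h.measurable_incr h.iIndepFun_incr h.map_incr K 0 i]
  refine measure_mono_ae ?_
  filter_upwards [h.ae_nonneg] with ω hω hle
  have := lindley_le (z := fun i => N.incr (ξ i ω)) hω (fun i => h.add_incr_le i ω) 0 i
  rw [zero_add] at this
  exact this.trans hle

theorem ae_eventually_gt (h : N.IsEnergyBuffer μ ξ B) (hψ : N.psi < 1) (K : ℝ) :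
    ∀ᵐ ω ∂μ, ∃ n, ∀ i ≥ n, K < B i ω := by
  obtain ⟨θ, hθ, hR⟩ := N.exists_laplace_incrLaw_lt_one hψ
  -- Borel–Cantelli, with a geometric series of ratio below 1 as majorant.
  have hsum : ∑' i, μ {ω | B i ω ≤ K} ≠ ∞ := by
    refine ne_top_of_le_ne_top ?_ (ENNReal.tsum_le_tsum fun i => (h.measure_le K i).trans
      (lindleyOp.iterate_lowLevel_le hθ hR.ne_top K i))
    rw [ENNReal.tsum_mul_left, ENNReal.tsum_geometric]
    exact ENNReal.mul_ne_top ENNReal.ofReal_ne_top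
      (ENNReal.inv_ne_top.2 (tsub_pos_of_lt hR).ne')
  filter_upwards [ae_eventually_notMem hsum] with ω hω
  simpa using eventually_atTop.1 hω

theorem tendsto_measure_gt (h : N.IsEnergyBuffer μ ξ B) (hψ : N.psi ≤ 1) (K : ℝ) :
    Tendsto (fun i => μ {ω | K < B i ω}) atTop (𝓝 1) := by
  have h0 : Tendsto (fun i => μ {ω | B i ω ≤ K}) atTop (𝓝 0) :=
    tendsto_of_tendsto_of_tendsto_of_le_of_le tendsto_const_nhds (N.tendsto_iterate_incrLaw hψ K)
      (fun _ => by simp) (h.measure_le K)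
  have h1 := ENNReal.Tendsto.sub (tendsto_const_nhds (x := (1 : ℝ≥0∞))) h0
    (Or.inl ENNReal.one_ne_top)
  rw [tsub_zero] at h1
  refine h1.congr fun i => ?_
  rw [← prob_compl_eq_one_sub (measurableSet_le (h.measurable i) measurable_const)]
  congr 1
  ext ω; simp

theorem ae_tendsto_average_gt (h : N.IsEnergyBuffer μ ξ B) (hψ : N.psi ≤ 1) (K : ℝ) :
    ∀ᵐ ω ∂μ, Tendsto (fun n : ℕ => (∑ i ∈ Finset.range n,
      Set.indicator {x : ℝ | K < x} 1 (B i ω)) / (n : ℝ)) atTop (𝓝 1) := by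
  filter_upwards [ae_tendsto_average_zero h.measurable_incr h.iIndepFun_incr h.map_incr
    (N.tendsto_iterate_incrLaw hψ K) h.ae_nonneg
    (ae_of_all _ fun ω i => h.add_incr_le i ω)] with ω hω
  have h1 := hω.const_sub 1
  rw [sub_zero] at h1
  refine h1.congr' ?_
  filter_upwards [eventually_gt_atTop 0] with n hn
  have hn' : (n : ℝ) ≠ 0 := by exact_mod_cast hn.ne'
  rw [eq_div_iff hn', sub_mul, div_mul_cancel₀ _ hn', one_mul, sub_eq_iff_eq_add,
    ← Finset.sum_add_distrib]
  have e : ∀ x : ℝ, Set.indicator {x : ℝ | K < x} (1 : ℝ → ℝ) x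
      + Set.indicator (Set.Iic K) (1 : ℝ → ℝ) x = 1 := by
    intro x
    by_cases hx : x ≤ K
    · simp [hx, hx.not_gt]
    · simp [hx, not_le.1 hx]
  simp [e]

end IsEnergyBuffer

end R1Network

end

theorem theorem4 (N : R1Network) (hψ : N.psi ≤ 1) :
    (¬ ∃ π : Measure ℝ, N.IsStationary π) ∧
    ∀ (Ω : Type*) [MeasurableSpace Ω] (μ : Measure Ω) [IsProbabilityMeasure μ]
      (ξ : ℕ → Ω → Slot) (B : ℕ → Ω → ℝ), N.IsEnergyBuffer μ ξ B →
      (N.psi < 1 → ∀ᵐ ω ∂μ, ∃ n, ∀ i ≥ n, N.M < B i ω) ∧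
      Tendsto (fun i => μ {ω | N.M < B i ω}) atTop (𝓝 1) ∧
      (∀ᵐ ω ∂μ, Tendsto (fun n : ℕ => (∑ i ∈ Finset.range n,
        Set.indicator {x : ℝ | N.M < x} 1 (B i ω)) / (n : ℝ)) atTop (𝓝 1)) := by
  refine ⟨fun ⟨π, hπ⟩ => N.not_isStationary hψ π hπ, ?_⟩
  intro Ω _ μ _ ξ B h
  exact ⟨fun hψ' => h.ae_eventually_gt hψ' N.M, h.tendsto_measure_gt hψ N.M,
    h.ae_tendsto_average_gt hψ N.M⟩
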